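/- Let $1\le p\le\infty$, let $L^p[0,1]$ be the complex $L^p$ space of Lebesgue measure on $[0,1]$, and let $V$ be the Volterra operator on it, i.e. the bounded linear operator given by $$(Vf)(s)=\int_0^s f(t)\,dt\qquad\text{for } f\in L^p[0,1] \text{ and (almost every) } s\in[0,1].$$ Then $V$ is not weakly l-sequentially supercyclic. Here a bounded linear operator $T$ on a complex normed space $X$ is called weakly l-sequentially supercyclic if there is a vector $y\in X$ such that every $x\in X$ is the weak limit of some sequence of elements of the projective orbit $\{\alpha T^n y:\alpha\in\mathbb{C},\ n\in\mathbb{N}_0\}$; a sequence $(x_k)$ converges weakly to $x$ if $g(x_k)\to g(x)$ for every bounded linear functional $g$ on $X$. -/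

import Mathlib

open MeasureTheory Filter Topology
open scoped ENNReal

noncomputable section

section Supercyclicity

variable {X : Type*} [NormedAddCommGroup X] [NormedSpace ℂ X]

/-- The orbit of the line spanned by `y` under `T`: all vectors `α Tⁿ y`
with `α` a complex number and `n ≥ 0`. -/
def projectiveOrbit (T : X →L[ℂ] X) (y : X) : Set X :=
  {z | ∃ (α : ℂ) (n : ℕ), z = α • (T ^ n) y}

/-- The weak limit set of `A`: all limits, in the weak topology of `X`, of weakly convergent
sequences of elements of `A`. -/
def weakLimitSet (A : Set X) : Set X :=
  {x | ∃ u : ℕ → X, (∀ k, u k ∈ A) ∧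
    Tendsto (fun k => toWeakSpace ℂ X (u k)) atTop (𝓝 (toWeakSpace ℂ X x))}

/-- Weak convergence of sequences, spelled out through bounded linear functionals. -/
theorem tendsto_toWeakSpace_iff (u : ℕ → X) (x : X) :
    Tendsto (fun k => toWeakSpace ℂ X (u k)) atTop (𝓝 (toWeakSpace ℂ X x)) ↔
      ∀ f : X →L[ℂ] ℂ, Tendsto (fun k => f (u k)) atTop (𝓝 (f x)) := by
  exact WeakBilin.tendsto_iff_forall_eval_tendsto (topDualPairing ℂ X).flip
    (fun a b h => (SeparatingDual.eq_iff_forall_dual_eq (R := ℂ)).2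
      fun f => DFunLike.congr_fun h f)

/-- `A` is weakly l-sequentially dense if its weak limit set is the whole space. -/
def IsWeaklyLSequentiallyDense (A : Set X) : Prop :=
  weakLimitSet A = Set.univ

/-- `T` is weakly l-sequentially supercyclic if the projective orbit of some vector is weakly
l-sequentially dense. -/
def IsWeaklyLSequentiallySupercyclic (T : X →L[ℂ] X) : Prop :=
  ∃ y : X, IsWeaklyLSequentiallyDense (projectiveOrbit T y)

end Supercyclicity

section Volterra

/-- Lebesgue measure on the interval `[0,1]`. -/
abbrev lebesgueUnit : Measure ℝ := volume.restrict (Set.Icc (0 : ℝ) 1)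

instance isProbabilityMeasure_lebesgueUnit : IsProbabilityMeasure lebesgueUnit :=
  ⟨by simp [lebesgueUnit]⟩

/-- The complex space `L^p[0,1]`. -/
abbrev LpUnit (p : ℝ≥0∞) : Type := Lp ℂ p lebesgueUnit

/-- The function `s ↦ ∫₀ˢ f(t) dt`. -/
def volterraFun (f : ℝ → ℂ) (s : ℝ) : ℂ := ∫ t in (0 : ℝ)..s, f t

variable {p : ℝ≥0∞} [Fact (1 ≤ p)]

theorem integrable_LpUnit (f : LpUnit p) : Integrable f lebesgueUnit :=
  (Lp.memLp f).integrable (Fact.out)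

theorem intervalIntegrable_LpUnit (f : LpUnit p) {s : ℝ} (hs : s ∈ Set.Icc (0 : ℝ) 1) :
    IntervalIntegrable f volume 0 s := by
  rw [intervalIntegrable_iff_integrableOn_Ioc_of_le hs.1]
  exact IntegrableOn.mono_set (t := Set.Icc (0 : ℝ) 1) (integrable_LpUnit f)
    (fun t ht => ⟨ht.1.le, ht.2.trans hs.2⟩)

theorem norm_volterraFun_le (f : LpUnit p) {s : ℝ} (hs : s ∈ Set.Icc (0 : ℝ) 1) :
    ‖volterraFun f s‖ ≤ ‖f‖ := by
  have h1 : ‖volterraFun f s‖ ≤ ∫ t, ‖f t‖ ∂lebesgueUnit := by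
    refine (intervalIntegral.norm_integral_le_integral_norm hs.1).trans ?_
    rw [intervalIntegral.integral_of_le hs.1]
    refine setIntegral_mono_set (t := Set.Icc (0 : ℝ) 1) (integrable_LpUnit f).norm
      (Eventually.of_forall fun t => norm_nonneg _) (LE.le.eventuallyLE ?_)
    exact fun t ht => ⟨ht.1.le, ht.2.trans hs.2⟩
  refine h1.trans ?_
  rw [integral_norm_eq_lintegral_enorm (Lp.aestronglyMeasurable f), ← eLpNorm_one_eq_lintegral_enorm,
    Lp.norm_def]
  exact ENNReal.toReal_mono (Lp.eLpNorm_ne_top f)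
    (eLpNorm_le_eLpNorm_of_exponent_le Fact.out (Lp.aestronglyMeasurable f))

theorem ae_norm_volterraFun_le (f : LpUnit p) :
    ∀ᵐ s ∂lebesgueUnit, ‖volterraFun f s‖ ≤ ‖f‖ :=
  (ae_restrict_mem measurableSet_Icc).mono fun _ hs => norm_volterraFun_le f hs

theorem memLp_volterraFun (f : LpUnit p) : MemLp (volterraFun f) p lebesgueUnit := by
  refine MemLp.of_bound (ContinuousOn.aestronglyMeasurable ?_ measurableSet_Icc) ‖f‖
    (ae_norm_volterraFun_le f)
  have h := intervalIntegral.continuousOn_primitive_interval (μ := volume) (f := f)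
    (a := 0) (b := 1) (by rw [Set.uIcc_of_le zero_le_one]; exact integrable_LpUnit f)
  rwa [Set.uIcc_of_le zero_le_one] at h

variable (p) in
/-- The Volterra operator on `L^p[0,1]`, `(V f)(s) = ∫₀ˢ f(t) dt`, as a bounded operator. -/
def volterra : LpUnit p →L[ℂ] LpUnit p :=
  LinearMap.mkContinuous
    { toFun := fun f => (memLp_volterraFun f).toLp (volterraFun f)
      map_add' := fun f g => by
        rw [← MemLp.toLp_add, MemLp.toLp_eq_toLp_iff]
        filter_upwards [ae_restrict_mem measurableSet_Icc] with s hs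
        rw [Pi.add_apply, volterraFun, volterraFun, volterraFun,
          ← intervalIntegral.integral_add (intervalIntegrable_LpUnit f hs)
            (intervalIntegrable_LpUnit g hs)]
        refine intervalIntegral.integral_congr_ae ?_
        filter_upwards [(ae_restrict_iff' measurableSet_Icc).1 (Lp.coeFn_add f g)] with t ht hts
        rw [Set.uIoc_of_le hs.1] at hts
        exact ht ⟨hts.1.le, hts.2.trans hs.2⟩
      map_smul' := fun c f => by
        rw [RingHom.id_apply, ← MemLp.toLp_const_smul, MemLp.toLp_eq_toLp_iff]
        filter_upwards [ae_restrict_mem measurableSet_Icc] with s hs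
        rw [Pi.smul_apply, volterraFun, volterraFun, ← intervalIntegral.integral_smul]
        refine intervalIntegral.integral_congr_ae ?_
        filter_upwards [(ae_restrict_iff' measurableSet_Icc).1 (Lp.coeFn_smul c f)] with t ht hts
        rw [Set.uIoc_of_le hs.1] at hts
        exact ht ⟨hts.1.le, hts.2.trans hs.2⟩ }
    1 (fun f => by
      rw [one_mul]
      have hb : ∀ᵐ s ∂lebesgueUnit,
          ‖(memLp_volterraFun f).toLp (volterraFun f) s‖ ≤ ‖f‖ := by
        filter_upwards [(memLp_volterraFun f).coeFn_toLp, ae_norm_volterraFun_le f] with s h1 h2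
        rw [h1]
        exact h2
      refine (Lp.norm_le_of_ae_bound (norm_nonneg _) hb).trans (le_of_eq ?_)
      have hm : measureUnivNNReal lebesgueUnit = 1 := by
        simp only [measureUnivNNReal, measure_univ, ENNReal.toNNReal_one]
      rw [hm, NNReal.coe_one, Real.one_rpow, one_mul])

/-- The defining formula of the Volterra operator, almost everywhere on `[0,1]`. -/
theorem volterra_coeFn (f : LpUnit p) :
    volterra p f =ᵐ[lebesgueUnit] fun s => ∫ t in (0 : ℝ)..s, f t :=
  (memLp_volterraFun f).coeFn_toLp

end Volterra

end

open scoped Nat unitInterval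

/-! ### Iterated primitives of a continuous function -/

section VolterraIterates

/-! Suppose the projective orbit of `y` reaches every function `1 + ict`, `c` real, as a weak
sequential limit of some `αₖ V^(nₖ) y`.

If `nₖ → ∞`, let `w` be the primitive of `y`. The limit has a nonzero primitive at each `η > 0`,
while `|Vⁿw(η)| ≤ B ηⁿ/n!`, so `|αₖ|` is at least of order `nₖ!/η^(nₖ)`. Weakly convergent sequences
are bounded, hence `V^(nₖ) w` is `O(η^(nₖ)/nₖ!)` uniformly on `[0,1]` for every `η` in `(0,1)`. Such
decay forces `w = 0` (`eqOn_zero_of_iterate_volterraFun_le`): it makes the moments of `w` against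
`(1-t)^j t^l`, `j ≥ nₖ`, so small that Bernstein approximation annihilates every test function
vanishing near `t = 1`. Then the primitive of the limit vanishes at 1, a contradiction.

So some exponent `m(c)` recurs infinitely often, and `1 + ict` is tied to the line of `V^(m(c)) y`.
These functions are pairwise independent, so `m : ℝ → ℕ` would be injective. -/

theorem hasDerivAt_volterraFun {w : ℝ → ℂ} (hw : Continuous w) (s : ℝ) :
    HasDerivAt (volterraFun w) (w s) s :=
  (hw.integral_hasStrictDerivAt 0 s).hasDerivAt

theorem continuous_volterraFun {w : ℝ → ℂ} (hw : Continuous w) : Continuous (volterraFun w) :=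
  continuous_iff_continuousAt.2 fun s => (hasDerivAt_volterraFun hw s).continuousAt

theorem continuous_iterate_volterraFun {w : ℝ → ℂ} (hw : Continuous w) (n : ℕ) :
    Continuous (volterraFun^[n] w) := by
  induction n with
  | zero => exact hw
  | succ n ih => rw [Function.iterate_succ_apply']; exact continuous_volterraFun ih

theorem norm_iterate_volterraFun_le {w : ℝ → ℂ} {B : ℝ}
    (hB : ∀ s ∈ Set.Icc (0 : ℝ) 1, ‖w s‖ ≤ B) (n : ℕ) {s : ℝ} (hs : s ∈ Set.Icc (0 : ℝ) 1) :
    ‖volterraFun^[n] w s‖ ≤ B * (s ^ n / n !) := by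
  induction n generalizing s with
  | zero => simpa using hB s hs
  | succ n ih =>
    rw [Function.iterate_succ_apply', volterraFun]
    have h : ‖∫ t in (0 : ℝ)..s, volterraFun^[n] w t‖ ≤ ∫ t in (0 : ℝ)..s, B * (t ^ n / n !) := by
      refine intervalIntegral.norm_integral_le_of_norm_le hs.1 ?_
        (Continuous.intervalIntegrable (by fun_prop) _ _)
      exact Eventually.of_forall fun t ht => ih ⟨ht.1.le, ht.2.trans hs.2⟩
    refine h.trans (le_of_eq ?_)
    rw [intervalIntegral.integral_const_mul, intervalIntegral.integral_div, integral_pow,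
      Nat.factorial_succ]
    push_cast
    rw [zero_pow n.succ_ne_zero, sub_zero]
    field_simp

/-! ### Moments and Bernstein approximation -/

theorem integral_one_sub_pow_succ_mul {w : ℝ → ℂ} (hw : Continuous w) (m : ℕ) :
    ∫ t in (0 : ℝ)..1, (1 - (t : ℂ)) ^ (m + 1) * w t =
      (m + 1) * ∫ t in (0 : ℝ)..1, (1 - (t : ℂ)) ^ m * volterraFun w t := by
  have hu (t : ℝ) : HasDerivAt (fun t : ℝ => (1 - (t : ℂ)) ^ (m + 1))
      (-((m + 1) * (1 - (t : ℂ)) ^ m)) t := by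
    exact ((((hasDerivAt_id t).ofReal_comp).const_sub (1 : ℂ)).fun_pow (m + 1)).congr_deriv
      (by simp)
  have hc := continuous_volterraFun hw
  rw [intervalIntegral.integral_mul_deriv_eq_deriv_mul (fun t _ => hu t)
    (fun t _ => hasDerivAt_volterraFun hw t)
    (Continuous.intervalIntegrable (by fun_prop) _ _) (hw.intervalIntegrable _ _)]
  simp only [neg_mul, intervalIntegral.integral_neg, mul_assoc,
    intervalIntegral.integral_const_mul]
  -- Both boundary terms vanish: the power of `1 - t` at 1, the primitive at 0.
  simp [volterraFun]

theorem factorial_mul_integral_one_sub_pow_mul {w : ℝ → ℂ} (hw : Continuous w) (m n : ℕ) :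
    (m ! : ℂ) * ∫ t in (0 : ℝ)..1, (1 - (t : ℂ)) ^ (m + n) * w t =
      ((m + n)! : ℂ) * ∫ t in (0 : ℝ)..1, (1 - (t : ℂ)) ^ m * volterraFun^[n] w t := by
  induction n generalizing w with
  | zero => rfl
  | succ n ih =>
    rw [Function.iterate_succ_apply, ← add_assoc, integral_one_sub_pow_succ_mul hw,
      Nat.factorial_succ]
    have := ih (continuous_volterraFun hw)
    push_cast at this ⊢
    linear_combination ((m : ℂ) + n + 1) * this

/-- Integrating by parts `n` times costs `m!/(m-n)!`; dividing by `n!` leaves a binomial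
coefficient, at most `2^m`. -/
theorem norm_integral_one_sub_pow_mul_le {w : ℝ → ℂ} (hw : Continuous w) {n : ℕ} {D : ℝ}
    (hD : ∀ s ∈ Set.Icc (0 : ℝ) 1, ‖volterraFun^[n] w s‖ ≤ D / n !) {m : ℕ} (hm : n ≤ m) :
    ‖∫ t in (0 : ℝ)..1, (1 - (t : ℂ)) ^ m * w t‖ ≤ D * 2 ^ m := by
  obtain ⟨j, rfl⟩ := Nat.exists_eq_add_of_le' hm
  have hD0 : 0 ≤ D := by
    have := (norm_nonneg _).trans (hD 0 (by simp))
    rwa [le_div_iff₀ (by positivity), zero_mul] at this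
  have h1 : ‖∫ t in (0 : ℝ)..1, (1 - (t : ℂ)) ^ j * volterraFun^[n] w t‖ ≤ D / n ! := by
    have := intervalIntegral.norm_integral_le_of_norm_le_const (a := (0 : ℝ)) (b := 1)
      (f := fun t => (1 - (t : ℂ)) ^ j * volterraFun^[n] w t) (C := D / n !) ?_
    · simpa using this
    intro t ht
    rw [Set.uIoc_of_le zero_le_one] at ht
    rw [norm_mul, norm_pow]
    have h2 : ‖1 - (t : ℂ)‖ ≤ 1 := by
      rw [← Complex.ofReal_one, ← Complex.ofReal_sub, Complex.norm_real, Real.norm_eq_abs, abs_le]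
      constructor <;> linarith [ht.1, ht.2]
    have h3 := hD t ⟨ht.1.le, ht.2⟩
    calc _ ≤ 1 * ‖volterraFun^[n] w t‖ := by
          gcongr
          exact pow_le_one₀ (norm_nonneg _) h2
      _ ≤ _ := by rwa [one_mul]
  have h2 := congrArg norm (factorial_mul_integral_one_sub_pow_mul hw j n)
  rw [norm_mul, norm_mul, Complex.norm_natCast, Complex.norm_natCast] at h2
  have h3 : ((j + n)! : ℝ) = (j + n).choose n * n ! * j ! := by
    rw [← Nat.add_choose_mul_factorial_mul_factorial j n, ← Nat.choose_symm_add]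
    push_cast; ring
  have h4 : ((j + n).choose n : ℝ) ≤ 2 ^ (j + n) := by
    exact_mod_cast Nat.choose_le_two_pow (j + n) n
  have hj : (0 : ℝ) < j ! := by positivity
  refine le_of_mul_le_mul_left ?_ hj
  calc _ = _ := h2
    _ ≤ ((j + n)! : ℝ) * (D / n !) := by gcongr
    _ = j ! * (D * (j + n).choose n) := by rw [h3]; field_simp
    _ ≤ _ := by gcongr

/-- Writing `t = 1 - (1 - t)` trades each factor `t` for the bounds at `j` and `j + 1`, and `2^j +
2^(j+1) = 3 · 2^j`. -/
theorem norm_integral_one_sub_pow_mul_pow_mul_le {w : ℝ → ℂ} (hw : Continuous w) {n : ℕ} {D : ℝ}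
    (hD : ∀ m, n ≤ m → ‖∫ t in (0 : ℝ)..1, (1 - (t : ℂ)) ^ m * w t‖ ≤ D * 2 ^ m) (l : ℕ) {j : ℕ}
    (hj : n ≤ j) :
    ‖∫ t in (0 : ℝ)..1, (1 - (t : ℂ)) ^ j * (t : ℂ) ^ l * w t‖ ≤ D * 2 ^ j * 3 ^ l := by
  induction l generalizing j with
  | zero => simpa using hD j hj
  | succ l ih =>
    have h : ∫ t in (0 : ℝ)..1, (1 - (t : ℂ)) ^ j * (t : ℂ) ^ (l + 1) * w t =
        (∫ t in (0 : ℝ)..1, (1 - (t : ℂ)) ^ j * (t : ℂ) ^ l * w t) -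
        ∫ t in (0 : ℝ)..1, (1 - (t : ℂ)) ^ (j + 1) * (t : ℂ) ^ l * w t := by
      rw [← intervalIntegral.integral_sub (Continuous.intervalIntegrable (by fun_prop) _ _)
        (Continuous.intervalIntegrable (by fun_prop) _ _)]
      exact intervalIntegral.integral_congr fun t _ => by ring
    rw [h]
    refine (norm_sub_le _ _).trans ((add_le_add (ih hj) (ih (hj.trans j.le_succ))).trans ?_)
    exact le_of_eq (by rw [Nat.succ_eq_add_one]; ring)

/-- Uniform convergence of Bernstein polynomials, for a function given on the real line. -/
theorem eventually_norm_bernstein_sum_sub_le {g : ℝ → ℂ} (hg : Continuous g) {ε : ℝ}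
    (hε : 0 < ε) : ∀ᶠ N : ℕ in atTop, ∀ r ∈ Set.Icc (0 : ℝ) 1,
      ‖∑ k ∈ Finset.range (N + 1), ((N.choose k : ℂ) * (r : ℂ) ^ k * (1 - (r : ℂ)) ^ (N - k)) *
        g (k / N) - g r‖ ≤ ε := by
  let f : C(I, ℂ) := ⟨fun x => g x, by fun_prop⟩
  filter_upwards [(Metric.tendsto_nhds.1 (bernsteinApproximation_uniform f)) ε hε] with N hN r hr
  have h := ((ContinuousMap.dist_apply_le_dist (⟨r, hr⟩ : I)).trans_lt hN).le
  rw [dist_eq_norm, bernsteinApproximation.apply] at h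
  rw [Finset.sum_range]
  simpa only [bernstein_apply, f, bernstein.z, ContinuousMap.coe_mk, Complex.real_smul,
    Complex.ofReal_mul, Complex.ofReal_pow, Complex.ofReal_sub, Complex.ofReal_one,
    Complex.ofReal_natCast] using h

/-- The vanishing of `g` below `n/N` removes the terms `k < n`, for which no moment bound is
available. The others cost `3^N` each, and the binomial weights sum to `2^N`. -/
theorem norm_integral_bernstein_sum_mul_le {w : ℝ → ℂ} (hw : Continuous w) {g : ℝ → ℂ} {G D : ℝ}
    {n N : ℕ} (hN : N ≠ 0) (hG : ∀ r ∈ Set.Icc (0 : ℝ) 1, ‖g r‖ ≤ G)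
    (hg : ∀ r : ℝ, r < n / N → g r = 0)
    (hD : ∀ s ∈ Set.Icc (0 : ℝ) 1, ‖volterraFun^[n] w s‖ ≤ D / n !) :
    ‖∫ t in (0 : ℝ)..1, (∑ k ∈ Finset.range (N + 1), ((N.choose k : ℂ) * (1 - (t : ℂ)) ^ k *
      (t : ℂ) ^ (N - k)) * g (k / N)) * w t‖ ≤ G * D * 6 ^ N := by
  have hG0 : 0 ≤ G := (norm_nonneg _).trans (hG 0 (by simp))
  have hD0 : 0 ≤ D := by
    have := (norm_nonneg _).trans (hD 0 (by simp))
    rwa [le_div_iff₀ (by positivity), zero_mul] at this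
  have hN0 : (0 : ℝ) < N := by positivity
  simp_rw [Finset.sum_mul]
  rw [intervalIntegral.integral_finsetSum
    fun k _ => Continuous.intervalIntegrable (by fun_prop) _ _]
  have key (k : ℕ) (hk : k ∈ Finset.range (N + 1)) :
      ‖∫ t in (0 : ℝ)..1, ((N.choose k : ℂ) * (1 - (t : ℂ)) ^ k * (t : ℂ) ^ (N - k)) *
        g (k / N) * w t‖ ≤ N.choose k * (G * D * 3 ^ N) := by
    have hkN : k ≤ N := Nat.lt_succ_iff.1 (Finset.mem_range.1 hk)
    rcases lt_or_ge k n with hkn | hkn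
    · rw [hg (k / N) (by gcongr)]
      simp only [mul_zero, zero_mul, intervalIntegral.integral_zero, norm_zero]
      positivity
    · have h : ∫ t in (0 : ℝ)..1, ((N.choose k : ℂ) * (1 - (t : ℂ)) ^ k * (t : ℂ) ^ (N - k)) *
          g (k / N) * w t = (N.choose k * g (k / N)) *
          ∫ t in (0 : ℝ)..1, (1 - (t : ℂ)) ^ k * (t : ℂ) ^ (N - k) * w t := by
        rw [← intervalIntegral.integral_const_mul]
        exact intervalIntegral.integral_congr fun t _ => by ring
      rw [h, norm_mul, norm_mul, Complex.norm_natCast, mul_assoc]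
      have h1 := norm_integral_one_sub_pow_mul_pow_mul_le hw
        (fun m hm => norm_integral_one_sub_pow_mul_le hw hD hm) (N - k) hkn
      have h2 : ‖g (k / N)‖ ≤ G :=
        hG _ ⟨by positivity, div_le_one_of_le₀ (by exact_mod_cast hkN) hN0.le⟩
      have h3 : (2 : ℝ) ^ k * 3 ^ (N - k) ≤ 3 ^ N := by
        calc (2 : ℝ) ^ k * 3 ^ (N - k) ≤ 3 ^ k * 3 ^ (N - k) := by gcongr; norm_num
          _ = 3 ^ N := by rw [← pow_add, Nat.add_sub_cancel' hkN]
      have h4 : D * 2 ^ k * 3 ^ (N - k) ≤ D * 3 ^ N := by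
        rw [mul_assoc]; gcongr
      rw [mul_assoc G]
      have h5 := h1.trans h4
      gcongr
  refine (norm_sum_le _ _).trans ((Finset.sum_le_sum key).trans (le_of_eq ?_))
  rw [← Finset.sum_mul, ← Nat.cast_sum, Nat.sum_range_choose, show (6 : ℝ) = 2 * 3 by norm_num,
    mul_pow]
  push_cast
  ring

/-- A continuous function vanishes on `[0,1]` if, along some sequence of orders, its iterated
primitives are smaller than `ηⁿ / n!` for every `η > 0`. -/
theorem eqOn_zero_of_iterate_volterraFun_le {w : ℝ → ℂ} (hw : Continuous w) {n : ℕ → ℕ}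
    (hn : Tendsto n atTop atTop)
    (h : ∀ η ∈ Set.Ioo (0 : ℝ) 1, ∃ C : ℝ, ∀ᶠ k in atTop, ∀ s ∈ Set.Icc (0 : ℝ) 1,
      ‖volterraFun^[n k] w s‖ ≤ C * η ^ n k / (n k)!) :
    Set.EqOn w 0 (Set.Icc 0 1) := by
  have main (g : ℝ → ℂ) (hg : Continuous g) (M : ℕ) (hM : M ≠ 0)
      (hg0 : ∀ r : ℝ, r < 1 / M → g r = 0) : ∫ t in (0 : ℝ)..1, g (1 - t) * w t = 0 := by
    obtain ⟨G, hG⟩ := (isCompact_Icc (a := (0 : ℝ)) (b := 1)).exists_bound_of_continuousOn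
      hg.continuousOn
    obtain ⟨B, hB⟩ := (isCompact_Icc (a := (0 : ℝ)) (b := 1)).exists_bound_of_continuousOn
      hw.continuousOn
    have hB0 : 0 ≤ B := (norm_nonneg _).trans (hB 0 (by simp))
    have h12 : (1 : ℝ) ≤ 6 ^ M := one_le_pow₀ (by norm_num)
    -- With degree `N = M · n k`, this `η` absorbs the loss `6^N` and leaves `2^(-n k)`.
    obtain ⟨C, hC⟩ := h ((6 ^ M)⁻¹ * 2⁻¹)
      ⟨by positivity, by
        have := inv_le_one_of_one_le₀ h12
        linarith⟩
    refine norm_le_zero_iff.1 (le_of_forall_pos_le_add fun ε hε => ?_)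
    have hlim : Tendsto (fun k => G * C * (2⁻¹ : ℝ) ^ n k) atTop (𝓝 0) := by
      simpa using ((tendsto_pow_atTop_nhds_zero_of_lt_one (r := (2⁻¹ : ℝ)) (by norm_num)
        (by norm_num)).comp hn).const_mul (G * C)
    have hMn : Tendsto (fun k => M * n k) atTop atTop :=
      hn.const_mul_atTop' (Nat.pos_of_ne_zero hM)
    have hδ : 0 < ε / 2 / (B + 1) := by positivity
    obtain ⟨k, hk1, hk2, hk3, hk4⟩ := (hC.and ((hlim.eventually_lt_const (half_pos hε)).and
      ((hMn.eventually (eventually_norm_bernstein_sum_sub_le hg hδ)).and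
        (hn.eventually_ne_atTop 0)))).exists
    set N := M * n k with hNdef
    have hN : N ≠ 0 := mul_ne_zero hM hk4
    have hnN : (n k : ℝ) / N = 1 / M := by
      rw [hNdef]; push_cast; field_simp
    have b1 := norm_integral_bernstein_sum_mul_le (n := n k) hw hN hG
      (fun r hr => hg0 r (hnN ▸ hr)) hk1
    have b2 : G * (C * ((6 ^ M)⁻¹ * 2⁻¹) ^ n k) * 6 ^ N = G * C * (2⁻¹ : ℝ) ^ n k := by
      rw [hNdef, pow_mul, mul_pow, inv_pow]
      field_simp
    rw [b2] at b1
    have b3 : ‖(∫ t in (0 : ℝ)..1, (∑ k ∈ Finset.range (N + 1), ((N.choose k : ℂ) *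
        (1 - (t : ℂ)) ^ k * (t : ℂ) ^ (N - k)) * g (k / N)) * w t) -
        ∫ t in (0 : ℝ)..1, g (1 - t) * w t‖ ≤ ε / 2 := by
      rw [← intervalIntegral.integral_sub (Continuous.intervalIntegrable (by fun_prop) _ _)
        (Continuous.intervalIntegrable (by fun_prop) _ _)]
      refine (intervalIntegral.norm_integral_le_of_norm_le_const
        (C := ε / 2 / (B + 1) * B) ?_).trans ?_
      · intro t ht
        rw [Set.uIoc_of_le zero_le_one] at ht
        rw [← sub_mul, norm_mul]
        have c1 := hk3 (1 - t) ⟨by linarith [ht.2], by linarith [ht.1]⟩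
        push_cast at c1
        rw [sub_sub_cancel] at c1
        have c2 := hB t ⟨ht.1.le, ht.2⟩
        gcongr
      · have : B / (B + 1) ≤ 1 := div_le_one_of_le₀ (by linarith) (by linarith)
        calc _ = ε / 2 * (B / (B + 1)) := by simp; ring
          _ ≤ ε / 2 * 1 := by gcongr
          _ = _ := mul_one _
    have b4 := norm_sub_norm_le (∫ t in (0 : ℝ)..1, g (1 - t) * w t)
      (∫ t in (0 : ℝ)..1, (∑ k ∈ Finset.range (N + 1), ((N.choose k : ℂ) *
        (1 - (t : ℂ)) ^ k * (t : ℂ) ^ (N - k)) * g (k / N)) * w t)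
    rw [norm_sub_rev] at b4
    linarith
  have hIco : Set.EqOn w 0 (Set.Ico 0 1) := by
    intro t ht
    by_contra hne
    -- The test function is a cutoff, positive at this `t`, times the conjugate of `w`; the integral
    -- becomes that of the cutoff times `‖w‖²`.
    obtain ⟨M, hM⟩ := exists_nat_one_div_lt (sub_pos.2 ht.2)
    have e := main (fun r => ((max (r - 1 / ((M : ℝ) + 1)) 0 : ℝ) : ℂ) *
      (starRingEnd ℂ) (w (1 - r))) (by fun_prop) (M + 1) M.succ_ne_zero (fun r hr => by
        push_cast at hr
        rw [max_eq_right (by linarith)]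
        simp)
    have e2 : ∫ t in (0 : ℝ)..1, ((max (1 - t - 1 / ((M : ℝ) + 1)) 0 * ‖w t‖ ^ 2 : ℝ) : ℂ) = 0 := by
      rw [← e]
      refine intervalIntegral.integral_congr fun t _ => ?_
      simp only [sub_sub_cancel, mul_assoc, Complex.conj_mul']
      push_cast
      rfl
    rw [intervalIntegral.integral_ofReal, Complex.ofReal_eq_zero] at e2
    refine (intervalIntegral.integral_pos (f := fun t => max (1 - t - 1 / ((M : ℝ) + 1)) 0 * ‖w t‖ ^ 2)
      zero_lt_one (by fun_prop) (fun t _ => by positivity) ⟨t, ⟨ht.1, ht.2.le⟩, ?_⟩).ne' e2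
    have h1 : 0 < ‖w t‖ := norm_pos_iff.2 hne
    have h2 : 0 < max (1 - t - 1 / ((M : ℝ) + 1)) 0 := lt_max_of_lt_left (by linarith)
    positivity
  exact hIco.of_subset_closure hw.continuousOn continuousOn_const Set.Ico_subset_Icc_self
    (by rw [closure_Ico zero_ne_one])

end VolterraIterates

/-! ### Point values of the primitive as functionals, and weak limits -/

section PrimitiveFunctional

theorem volterraFun_congr_ae {f g : ℝ → ℂ} (h : f =ᵐ[lebesgueUnit] g) {s : ℝ}
    (hs : s ∈ Set.Icc (0 : ℝ) 1) : volterraFun f s = volterraFun g s := by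
  refine intervalIntegral.integral_congr_ae ?_
  filter_upwards [(ae_restrict_iff' measurableSet_Icc).1 h] with t ht hts
  rw [Set.uIoc_of_le hs.1] at hts
  exact ht ⟨hts.1.le, hts.2.trans hs.2⟩

variable {p : ℝ≥0∞} [Fact (1 ≤ p)]

variable (p) in
/-- The bounded linear functional `f ↦ ∫₀ˢ f(t) dt` on `L^p[0,1]`. -/
noncomputable def primitiveAt (s : Set.Icc (0 : ℝ) 1) : LpUnit p →L[ℂ] ℂ :=
  LinearMap.mkContinuous
    { toFun := fun f => volterraFun f s
      map_add' := fun f g => by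
        rw [volterraFun_congr_ae (Lp.coeFn_add f g) s.2]
        exact intervalIntegral.integral_add (intervalIntegrable_LpUnit f s.2)
          (intervalIntegrable_LpUnit g s.2)
      map_smul' := fun c f => by
        rw [volterraFun_congr_ae (Lp.coeFn_smul c f) s.2]
        exact intervalIntegral.integral_smul c f }
    1 (fun f => by
      rw [one_mul]
      exact norm_volterraFun_le f s.2)

theorem primitiveAt_apply (s : Set.Icc (0 : ℝ) 1) (f : LpUnit p) :
    primitiveAt p s f = volterraFun f s := rfl

theorem norm_primitiveAt_apply_le (s : Set.Icc (0 : ℝ) 1) (f : LpUnit p) :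
    ‖primitiveAt p s f‖ ≤ ‖f‖ := norm_volterraFun_le f s.2

/-- Here `w` is the primitive of `y` extended by zero, hence continuous on all of `ℝ`. The
functional supplies one integration, so the exponent stays `n`. -/
theorem exists_continuous_primitiveAt_volterra_pow (y : LpUnit p) :
    ∃ w : ℝ → ℂ, Continuous w ∧ ∀ (n : ℕ) (s : Set.Icc (0 : ℝ) 1),
      primitiveAt p s ((volterra p ^ n) y) = volterraFun^[n] w s := by
  have hi : Integrable ((Set.Icc (0 : ℝ) 1).indicator y) volume :=
    (integrable_indicator_iff measurableSet_Icc).2 (integrable_LpUnit y)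
  refine ⟨volterraFun ((Set.Icc (0 : ℝ) 1).indicator y),
    intervalIntegral.continuous_primitive (fun a b => hi.intervalIntegrable) 0, fun n => ?_⟩
  induction n with
  | zero =>
    intro s
    refine volterraFun_congr_ae ?_ s.2
    filter_upwards [ae_restrict_mem measurableSet_Icc] with t ht
    simp [Set.indicator_of_mem ht]
  | succ n ih =>
    intro s
    rw [Function.iterate_succ_apply', pow_succ', mul_apply_eq_comp]
    refine volterraFun_congr_ae ?_ s.2
    filter_upwards [volterra_coeFn ((volterra p ^ n) y), ae_restrict_mem measurableSet_Icc]
      with t h1 h2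
    rw [h1]
    exact ih ⟨t, h2⟩

/-- Uniform boundedness is applied in the bidual, so only the dual has to be complete. -/
theorem exists_norm_le_of_forall_dual_tendsto {X : Type*} [NormedAddCommGroup X]
    [NormedSpace ℂ X] {u : ℕ → X} {x : X}
    (h : ∀ f : X →L[ℂ] ℂ, Tendsto (fun k => f (u k)) atTop (𝓝 (f x))) :
    ∃ C, ∀ k, ‖u k‖ ≤ C := by
  obtain ⟨C, hC⟩ := banach_steinhaus (g := fun k => NormedSpace.inclusionInDoubleDual ℂ X (u k))
    (fun f => by
      obtain ⟨C, hC⟩ := (h f).norm.bddAbove_range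
      exact ⟨C, fun k => hC ⟨k, rfl⟩⟩)
  refine ⟨C, fun k => ?_⟩
  rw [← (NormedSpace.inclusionInDoubleDualLi (E := X) ℂ).norm_map]
  exact hC k

/-- Multiples of `Vⁿ y` with `n → ∞` cannot converge weakly to a function whose primitive has no
zero in `(0,1]`. -/
theorem not_forall_dual_tendsto_smul_volterra_pow {y x : LpUnit p} {α : ℕ → ℂ} {n : ℕ → ℕ}
    (hn : Tendsto n atTop atTop)
    (hx : ∀ s : Set.Icc (0 : ℝ) 1, 0 < (s : ℝ) → primitiveAt p s x ≠ 0)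
    (h : ∀ f : LpUnit p →L[ℂ] ℂ,
      Tendsto (fun k => f (α k • (volterra p ^ n k) y)) atTop (𝓝 (f x))) : False := by
  obtain ⟨w, hw, hwy⟩ := exists_continuous_primitiveAt_volterra_pow y
  obtain ⟨C, hC⟩ := exists_norm_le_of_forall_dual_tendsto h
  obtain ⟨B, hB⟩ := (isCompact_Icc (a := (0 : ℝ)) (b := 1)).exists_bound_of_continuousOn
    hw.continuousOn
  have hB0 : 0 ≤ B := (norm_nonneg _).trans (hB 0 (by simp))
  have hval (k : ℕ) (s : Set.Icc (0 : ℝ) 1) :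
      ‖primitiveAt p s (α k • (volterra p ^ n k) y)‖ = ‖α k‖ * ‖volterraFun^[n k] w s‖ := by
    rw [map_smul, norm_smul, hwy]
  have hzero : Set.EqOn w 0 (Set.Icc 0 1) := by
    refine eqOn_zero_of_iterate_volterraFun_le hw hn fun η hη => ?_
    let t : Set.Icc (0 : ℝ) 1 := ⟨η, hη.1.le, hη.2.le⟩
    have hd : 0 < ‖primitiveAt p t x‖ := norm_pos_iff.2 (hx t hη.1)
    refine ⟨C * B / (‖primitiveAt p t x‖ / 2), ?_⟩
    -- Eventually the value at `η` exceeds half its nonzero limit, which bounds `‖α k‖` from below.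
    filter_upwards [(h (primitiveAt p t)).norm.eventually_const_lt (half_lt_self hd)]
      with k hk s hs
    rw [hval] at hk
    have h1 := norm_iterate_volterraFun_le hB (n k) t.2
    have h2 := (hval k ⟨s, hs⟩).symm.trans_le ((norm_primitiveAt_apply_le _ _).trans (hC k))
    rw [div_mul_eq_mul_div, div_div, mul_comm (‖primitiveAt p t x‖ / 2), ← div_div,
      le_div_iff₀ (half_pos hd)]
    calc ‖volterraFun^[n k] w s‖ * (‖primitiveAt p t x‖ / 2)
        ≤ ‖volterraFun^[n k] w s‖ * (‖α k‖ * (B * (η ^ n k / (n k).factorial))) := by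
          refine mul_le_mul_of_nonneg_left (hk.le.trans ?_) (norm_nonneg _)
          exact mul_le_mul_of_nonneg_left h1 (norm_nonneg _)
      _ = (‖α k‖ * ‖volterraFun^[n k] w s‖) * (B * (η ^ n k / (n k).factorial)) := by ring
      _ ≤ C * (B * (η ^ n k / (n k).factorial)) := by
          refine mul_le_mul_of_nonneg_right h2 ?_
          have := hη.1
          positivity
      _ = _ := by ring
  refine hx ⟨1, by simp⟩ zero_lt_one (tendsto_nhds_unique (h _) ?_)
  refine tendsto_const_nhds.congr fun k => (norm_eq_zero.1 ?_).symm
  have h0 : volterraFun^[n k] w 1 = 0 := by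
    have := norm_iterate_volterraFun_le (w := w) (B := 0) (fun s hs => by simp [hzero hs]) (n k)
      (s := 1) (by simp)
    simpa using this
  rw [hval, h0, norm_zero, mul_zero]

omit [Fact (1 ≤ p)] in
theorem memLp_one_add_mul (c : ℝ) :
    MemLp (fun t : ℝ => 1 + (c : ℂ) * Complex.I * t) p lebesgueUnit := by
  refine MemLp.of_bound (by fun_prop) (1 + |c|) ?_
  filter_upwards [ae_restrict_mem measurableSet_Icc] with t ht
  refine (norm_add_le _ _).trans ?_
  simp only [norm_one, norm_mul, Complex.norm_real, Complex.norm_I, mul_one, Real.norm_eq_abs,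
    abs_of_nonneg ht.1]
  nlinarith [abs_nonneg c, ht.2]

variable (p) in
/-- The function `t ↦ 1 + i c t` as an element of `L^p[0,1]`. -/
noncomputable def affineLp (c : ℝ) : LpUnit p := (memLp_one_add_mul c).toLp _

theorem primitiveAt_affineLp (c : ℝ) (s : Set.Icc (0 : ℝ) 1) :
    primitiveAt p s (affineLp p c) = (s : ℝ) + c * Complex.I * ((s : ℝ) ^ 2 / 2) := by
  rw [primitiveAt_apply, affineLp, volterraFun_congr_ae (memLp_one_add_mul c).coeFn_toLp s.2,
    volterraFun, intervalIntegral.integral_add (Continuous.intervalIntegrable (by fun_prop) _ _)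
      (Continuous.intervalIntegrable (by fun_prop) _ _), intervalIntegral.integral_const_mul,
    intervalIntegral.integral_ofReal, integral_id]
  simp

/-- The real part is `s`; the parameter `c` only enters the imaginary part. -/
theorem primitiveAt_affineLp_ne_zero (c : ℝ) (s : Set.Icc (0 : ℝ) 1) (hs : 0 < (s : ℝ)) :
    primitiveAt p s (affineLp p c) ≠ 0 := by
  rw [primitiveAt_affineLp]
  intro h
  have := congrArg Complex.re h
  simp [pow_two] at this
  simp [this] at hs

/-- If a sequence in the projective orbit of `y` visits the line of `v` infinitely often and
converges weakly, then every two functionals are proportional on `v` and on the limit. -/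
theorem mul_eq_mul_of_frequently_mem_span {X : Type*} [NormedAddCommGroup X] [NormedSpace ℂ X]
    {u : ℕ → X} {x v : X} (h : ∀ f : X →L[ℂ] ℂ, Tendsto (fun k => f (u k)) atTop (𝓝 (f x)))
    (hv : ∃ᶠ k in atTop, ∃ a : ℂ, u k = a • v) (f g : X →L[ℂ] ℂ) : f x * g v = g x * f v := by
  have h1 : Tendsto (fun k => f (u k) * g v - g (u k) * f v) atTop (𝓝 (f x * g v - g x * f v)) :=
    ((h f).mul_const _).sub ((h g).mul_const _)
  refine sub_eq_zero.1 (isClosed_singleton.mem_of_frequently_of_tendsto (hv.mono ?_) h1)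
  rintro k ⟨a, ha⟩
  simp only [ha, map_smul, smul_eq_mul, Set.mem_singleton_iff]
  ring

theorem apply_ne_zero_of_frequently_mem_span {X : Type*} [NormedAddCommGroup X]
    [NormedSpace ℂ X] {u : ℕ → X} {x v : X}
    (h : ∀ f : X →L[ℂ] ℂ, Tendsto (fun k => f (u k)) atTop (𝓝 (f x)))
    (hv : ∃ᶠ k in atTop, ∃ a : ℂ, u k = a • v) {f : X →L[ℂ] ℂ} (hf : f x ≠ 0) : f v ≠ 0 := by
  intro h0
  refine hf (isClosed_singleton.mem_of_frequently_of_tendsto (hv.mono ?_) (h f))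
  rintro k ⟨a, ha⟩
  simp [ha, h0]

end PrimitiveFunctional

/-! ### Uncountably many targets against countably many exponents -/

theorem corollary4p1 (p : ℝ≥0∞) [Fact (1 ≤ p)] :
    ¬ IsWeaklyLSequentiallySupercyclic (volterra p) := by
  rintro ⟨y, hy⟩
  have hseq (c : ℝ) : ∃ (α : ℕ → ℂ) (n : ℕ → ℕ), ∀ f : LpUnit p →L[ℂ] ℂ,
      Tendsto (fun k => f (α k • (volterra p ^ n k) y)) atTop (𝓝 (f (affineLp p c))) := by
    obtain ⟨u, hu, hlim⟩ : affineLp p c ∈ weakLimitSet (projectiveOrbit (volterra p) y) := by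
      rw [IsWeaklyLSequentiallyDense] at hy
      exact hy ▸ Set.mem_univ _
    choose α n hαn using hu
    refine ⟨α, n, ?_⟩
    simp_rw [← hαn]
    exact (tendsto_toWeakSpace_iff _ _).1 hlim
  choose α n hlim using hseq
  have hfreq (c : ℝ) : ∃ m, ∃ᶠ k in atTop, n c k = m := by
    by_contra! hne
    refine not_forall_dual_tendsto_smul_volterra_pow ?_ (primitiveAt_affineLp_ne_zero c) (hlim c)
    -- Exponents that eventually leave every value tend to infinity.
    exact (le_cofinite_iff_eventually_ne.2 fun m => eventually_map.2 (hne m)).trans_eq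
      Nat.cofinite_eq_atTop
  choose m hm using hfreq
  have hinj : Function.Injective m := by
    intro c c' hcc
    let a : Set.Icc (0 : ℝ) 1 := ⟨1, by simp⟩
    let b : Set.Icc (0 : ℝ) 1 := ⟨1 / 2, by norm_num, by norm_num⟩
    have hv (d : ℝ) : ∃ᶠ k in atTop, ∃ z : ℂ,
        α d k • (volterra p ^ n d k) y = z • (volterra p ^ m d) y :=
      (hm d).mono fun k hk => ⟨α d k, by rw [hk]⟩
    have h1 := mul_eq_mul_of_frequently_mem_span (hlim c) (hv c) (primitiveAt p a)
      (primitiveAt p b)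
    have h2 := mul_eq_mul_of_frequently_mem_span (hlim c') (hv c') (primitiveAt p a)
      (primitiveAt p b)
    have h3 := apply_ne_zero_of_frequently_mem_span (hlim c) (hv c)
      (primitiveAt_affineLp_ne_zero c a zero_lt_one)
    rw [← hcc] at h2
    rw [primitiveAt_affineLp, primitiveAt_affineLp] at h1 h2
    set A := primitiveAt p a ((volterra p ^ m c) y)
    set E := primitiveAt p b ((volterra p ^ m c) y)
    simp only [a, b] at h1 h2
    push_cast at h1 h2
    -- Eliminating `E` leaves the determinant of the primitives of the two targets at 1 and 1/2, a
    -- multiple of `c - c'`; the factor 8 clears denominators.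
    have h4 : A * ((c : ℂ) - c') * Complex.I = 0 := by
      linear_combination 8 * (1 + c' * Complex.I / 2) * h1 - 8 * (1 + c * Complex.I / 2) * h2
    have h5 : (c : ℂ) - c' = 0 := by
      simpa [h3, Complex.I_ne_zero] using h4
    exact_mod_cast sub_eq_zero.1 h5
  have := hinj.countable
  exact Cardinal.not_countable_real (Set.countable_univ_iff.2 this)
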